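/- Let $\Bbbk$ be an algebraically closed field of characteristic zero, let $\mathfrak g$ be a finite-dimensional simple Lie algebra over $\Bbbk$, and let $G$ be its adjoint group, i.e. the subgroup of $GL(\mathfrak g)$ generated by all $\exp(\operatorname{ad}x)$ with $\operatorname{ad}x$ nilpotent. A nilpotent orbit is a $G$-orbit of an ad-nilpotent element. A nilpotent orbit $\mathcal O\subset\mathfrak g$ is called a low-$A_2$ orbit if there are a nilpotent orbit $\tilde{\mathcal O}\subset\mathfrak g$ and a subalgebra $\mathfrak s\subset\mathfrak g$ isomorphic to $\mathfrak{sl}_3$ such that $\tilde{\mathcal O}\cap\mathfrak s$ is the regular nilpotent orbit of $\mathfrak s$ (corresponding to the orbit of $E_{12}+E_{23}$ in $\mathfrak{sl}_3$) and $\mathcal O\cap\mathfrak s$ is the minimal nilpotent orbit of $\mathfrak s$ (corresponding to the orbit of $E_{13}$). **Theorem 4.3.** Let $\mathcal O$ be a low-$A_2$ orbit, let $e\in\mathcal O$, and let $\{e,h,f\}$ be an $\mathfrak{sl}_2$-triple: $[e,f]=h$, $[h,e]=2e$, $[h,f]=-2f$. Let $\mathfrak g^e=\{x\in\mathfrak g\mid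 [e,x]=0\}$ be the centraliser of $e$, and for $i\in\mathbb Z$ put $\mathfrak g^e(i)=\{x\in\mathfrak g^e\mid [h,x]=ix\}$ and $\mathfrak g^e_{nil}=\bigoplus_{i\ge 1}\mathfrak g^e(i)$ (the nilpotent radical of $\mathfrak g^e$). Then there are $e_1,e_2\in\mathfrak g^e(1)$ such that $$\mathfrak g^e(i)=[\mathfrak g^e(i-1),e_1]+[\mathfrak g^e(i-1),e_2]\qquad\text{for all } i\ge 1,$$ and the Lie algebra $\mathfrak g^e$ is generated by $\mathfrak g^e(0)$, $e_1$ and $e_2$. Moreover, the Lie algebra $\mathfrak g^e_{nil}$ is generated by $\mathfrak g^e(1)$, and $\mathfrak g^e_{nil}\subset[\mathfrak g^e,\mathfrak g^e]$. -/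

import Mathlib

namespace LowA2

open LieAlgebra

section Orbits

variable (k : Type*) [Field k] {L : Type*} [LieRing L] [LieAlgebra k L]

/-- The exponential `exp (ad x) = ∑ (ad x)ⁱ / i!`; it is used only for ad-nilpotent `x`, where the
sum over `i < nilpotencyClass (ad x)` is the whole exponential series. -/
noncomputable def expAd (x : L) : L →ₗ[k] L :=
  ∑ i ∈ Finset.range (nilpotencyClass (ad k L x)), (i.factorial : k)⁻¹ • (ad k L x) ^ i

variable (L) in
/-- The adjoint group of `L`, as a subgroup of `GL(L)`: the group generated by all `exp (ad x)`
with `ad x` nilpotent. For `L` semisimple over an algebraically closed field of characteristic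
zero this is the image `Ad G` of every connected algebraic group `G` with Lie algebra `L`, that is,
the identity component of `Aut L`. -/
def adjointGroup : Subgroup (L ≃ₗ[k] L) :=
  Subgroup.closure
    {g | ∃ x : L, IsNilpotent (ad k L x) ∧ (g : L →ₗ[k] L) = expAd k x}

/-- The orbit `G · x` of `x` under the adjoint group. -/
def adjointOrbit (x : L) : Set L :=
  {y | ∃ g ∈ adjointGroup k L, y = g x}

/-- A nilpotent orbit: the orbit of an element `x` with `ad x` nilpotent. -/
def IsNilpotentOrbit (O : Set L) : Prop :=
  ∃ x : L, IsNilpotent (ad k L x) ∧ O = adjointOrbit k x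

/-- The regular nilpotent orbit of `𝔰𝔩₃`: the orbit of `E₁₂ + E₂₃`, the sum of the two simple root
vectors (a nilpotent matrix with a single Jordan block). -/
def regularOrbitSl3 : Set (SpecialLinear.sl (Fin 3) k) :=
  adjointOrbit k (SpecialLinear.single (0 : Fin 3) 1 (by decide) (1 : k) +
    SpecialLinear.single (1 : Fin 3) 2 (by decide) (1 : k))

/-- The minimal nilpotent orbit of `𝔰𝔩₃`: the orbit of the highest root vector `E₁₃`. -/
def minimalOrbitSl3 : Set (SpecialLinear.sl (Fin 3) k) :=
  adjointOrbit k (SpecialLinear.single (0 : Fin 3) 2 (by decide) (1 : k))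

/-- `(O', O)` is an `A₂`-pair of nilpotent orbits of `L`: there is a subalgebra `s ≃ 𝔰𝔩₃` of `L`
such that `O' ∩ s` is the regular and `O ∩ s` the minimal nilpotent orbit of `s`. -/
def IsA2Pair (O' O : Set L) : Prop :=
  IsNilpotentOrbit k O' ∧ IsNilpotentOrbit k O ∧
    ∃ (s : LieSubalgebra k L) (φ : SpecialLinear.sl (Fin 3) k ≃ₗ⁅k⁆ s),
      O' ∩ (s : Set L) = (fun x => (φ x : L)) '' regularOrbitSl3 k ∧
      O ∩ (s : Set L) = (fun x => (φ x : L)) '' minimalOrbitSl3 k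

/-- `O` is a low-`A₂` orbit. -/
def IsLowA2Orbit (O : Set L) : Prop :=
  ∃ O' : Set L, IsA2Pair k O' O

end Orbits

section Centraliser

variable (k : Type*) [Field k] {L : Type*} [LieRing L] [LieAlgebra k L]

/-- The centraliser `𝔤ᵉ = {x | [e, x] = 0}`. -/
def centraliser (e : L) : Submodule k L :=
  LinearMap.ker (ad k L e)

/-- `𝔤(i) = {x | [h, x] = i x}`. -/
def gradedPiece (h : L) (i : ℤ) : Submodule k L :=
  LinearMap.ker (ad k L h - (i : k) • LinearMap.id)

/-- `𝔤ᵉ(i) = 𝔤ᵉ ∩ 𝔤(i)`, the grading being given by `h`. -/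
def centraliserPiece (e h : L) (i : ℤ) : Submodule k L :=
  centraliser k e ⊓ gradedPiece k h i

/-- `𝔤ᵉ_nil = 𝔤ᵉ(≥ 1)`, the sum of all `𝔤ᵉ(i)` with `i ≥ 1`. -/
def centraliserNil (e h : L) : Submodule k L :=
  ⨆ i : ℤ, ⨆ _ : 1 ≤ i, centraliserPiece k e h i

/-- `[V, y] = {[x, y] | x ∈ V}`, for a subspace `V` and an element `y`. -/
def lieRight (V : Submodule k L) (y : L) : Submodule k L :=
  V.map ((LieModule.toEnd k L L : L →ₗ[k] Module.End k L).flip y)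

/-- `[V, W]`, the linear span of all `[x, y]` with `x ∈ V` and `y ∈ W`. -/
def lieSpanBracket (V W : Submodule k L) : Submodule k L :=
  Submodule.span k {z | ∃ x ∈ V, ∃ y ∈ W, z = ⁅x, y⁆}

end Centraliser

end LowA2

/-! The element `e` is a highest root vector `E₁₃` of a copy of `𝔰𝔩₃` in `L`. An automorphism fixing
`e` moves the neutral element of that copy to the given `h` (`exists_lieEquiv_neutral_eq`), so one
may take `e₁ = p = E₁₂` and `e₂ = q = E₂₃` (`exists_sl3System`).

The rest is a fact on finite-dimensional `𝔰𝔩₃`-modules, `Sl3System.exists_lie_add_lie_eq`, applied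
to `L` itself. On the vectors of weight `i + 1` killed by `e`, let `S = p'p + q'q`. Moving upwards
by `p` and `q` shows that the eigenvalues of `S` are natural numbers, so `S + (i + 2)` is invertible
there. If `w = (S + i + 2) v`, then explicit corrections of `p'v` and `q'v` by `f` are killed by
`e`, have weight `i`, and give `w = p u₁ + q u₂`. Since the weights of `h` on `𝔤ᵉ` are natural
numbers, all the generation statements follow by induction on the weight.

Neither Weyl's theorem nor a classification of modules is needed: Casimir and commutator identities
give the `𝔰𝔩₂`-theory directly. -/

namespace LowA2

open LieAlgebra LieModule

/-! ### Nilpotency of eigenvectors of a commutator. -/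

section Nilpotent

/-- In characteristic zero, an eigenvector of `[A, ·]` with nonzero eigenvalue is nilpotent. -/
lemma isNilpotent_of_mul_sub_mul_eq_smul {k V : Type*} [Field k] [CharZero k] [AddCommGroup V]
    [Module k V] [FiniteDimensional k V] {A B : Module.End k V} {c : k} (hc : c ≠ 0)
    (hAB : A * B - B * A = c • B) : IsNilpotent B := by
  by_contra hB
  have hpow (n : ℕ) : A * B ^ n - B ^ n * A = ((n : k) * c) • B ^ n := by
    induction n with
    | zero => simp
    | succ n ih =>
      have h1 : A * B ^ (n + 1) - B ^ (n + 1) * A =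
          (A * B ^ n - B ^ n * A) * B + B ^ n * (A * B - B * A) := by
        rw [pow_succ]; noncomm_ring
      rw [h1, ih, hAB, smul_mul_assoc, mul_smul_comm, ← pow_succ, ← add_smul]
      congr 1
      push_cast
      ring
  let T : Module.End k (Module.End k V) := LinearMap.mulLeft k A - LinearMap.mulRight k A
  have hinj : Function.Injective fun n : ℕ => (n : k) * c := fun m n hmn => by
    simpa [hc] using hmn
  -- If no power of `B` vanished, the powers would be eigenvectors of `[A, ·]` for infinitely many
  -- distinct eigenvalues.
  have hli := T.eigenvectors_linearIndependent' (fun n : ℕ => (n : k) * c) hinj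
    (fun n : ℕ => B ^ n) fun n => by
      rw [Module.End.hasEigenvector_iff, Module.End.mem_eigenspace_iff]
      exact ⟨hpow n, fun h0 => hB ⟨n, h0⟩⟩
  have := hli.finite
  exact not_finite ℕ

end Nilpotent

/-! ### Finite-dimensional representations of `𝔰𝔩₂`. -/

section Sl2

variable {k : Type*} [Field k] {L : Type*} [LieRing L] [LieAlgebra k L]
  {M : Type*} [AddCommGroup M] [Module k M] [LieRingModule L M] [LieModule k L M]
  {h e f : L}

variable (k M) in
/-- The vectors of weight `c` for `h` which are killed by `e`. -/
def highestWeightSpace (e h : L) (c : k) : Submodule k M :=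
  LinearMap.ker (toEnd k L M e) ⊓ LinearMap.ker (toEnd k L M h - c • LinearMap.id)

lemma mem_highestWeightSpace {c : k} {v : M} :
    v ∈ highestWeightSpace k M e h c ↔ ⁅e, v⁆ = 0 ∧ ⁅h, v⁆ = c • v := by
  simp [highestWeightSpace, sub_eq_zero]

section Relations

variable (t : IsSl2Triple h e f) (v : M)
include t

omit [LieAlgebra k L] [Module k M] [LieModule k L M] in
lemma lie_h_mem_ker_e {v : M} (he : ⁅e, v⁆ = 0) : ⁅e, ⁅h, v⁆⁆ = 0 := by
  rw [leibniz_lie, ← lie_skew, t.lie_h_e_nsmul, he, neg_lie, nsmul_lie, he]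
  simp

lemma sl2_h_e : ⁅h, ⁅e, v⁆⁆ = ⁅e, ⁅h, v⁆⁆ + (2 : k) • ⁅e, v⁆ := by
  rw [leibniz_lie, t.lie_h_e_smul k, smul_lie, add_comm]

lemma sl2_h_f : ⁅h, ⁅f, v⁆⁆ = ⁅f, ⁅h, v⁆⁆ - (2 : k) • ⁅f, v⁆ := by
  rw [leibniz_lie, t.lie_lie_smul_f k, neg_lie, smul_lie]; abel

omit [LieAlgebra k L] [Module k M] [LieModule k L M] in
lemma sl2_e_f : ⁅e, ⁅f, v⁆⁆ = ⁅f, ⁅e, v⁆⁆ + ⁅h, v⁆ := by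
  rw [leibniz_lie, t.lie_e_f, add_comm]

end Relations

variable (k M) in
/-- The Casimir operator `4fe + h² + 2h` of an `𝔰𝔩₂`-triple. -/
def casimirSl2 (h e f : L) : Module.End k M :=
  (4 : k) • (toEnd k L M f * toEnd k L M e) + toEnd k L M h * toEnd k L M h +
    (2 : k) • toEnd k L M h

lemma casimirSl2_apply (v : M) :
    casimirSl2 k M h e f v = (4 : k) • ⁅f, ⁅e, v⁆⁆ + ⁅h, ⁅h, v⁆⁆ + (2 : k) • ⁅h, v⁆ := by
  simp [casimirSl2]

lemma casimirSl2_e (t : IsSl2Triple h e f) (v : M) :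
    casimirSl2 k M h e f ⁅e, v⁆ = ⁅e, casimirSl2 k M h e f v⁆ := by
  simp only [casimirSl2_apply, lie_add, lie_smul, sl2_h_e (k := k) t, sl2_e_f t]
  module

lemma casimirSl2_f (t : IsSl2Triple h e f) (v : M) :
    casimirSl2 k M h e f ⁅f, v⁆ = ⁅f, casimirSl2 k M h e f v⁆ := by
  simp only [casimirSl2_apply, lie_add, lie_sub, lie_smul, sl2_h_f (k := k) t, sl2_e_f t]
  module

lemma casimirSl2_h (t : IsSl2Triple h e f) (v : M) :
    casimirSl2 k M h e f ⁅h, v⁆ = ⁅h, casimirSl2 k M h e f v⁆ := by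
  simp only [casimirSl2_apply, lie_add, lie_smul, sl2_h_e (k := k) t, sl2_h_f (k := k) t]
  module

variable [CharZero k] [FiniteDimensional k M]

lemma isNilpotent_toEnd_f (t : IsSl2Triple h e f) : IsNilpotent (toEnd k L M f) := by
  refine isNilpotent_of_mul_sub_mul_eq_smul (A := toEnd k L M h) (c := -2) (by simp) ?_
  ext v
  simp [sl2_h_f (k := k) t]

lemma isNilpotent_toEnd_e (t : IsSl2Triple h e f) : IsNilpotent (toEnd k L M e) :=
  isNilpotent_toEnd_f t.symm

omit [CharZero k] [FiniteDimensional k M] in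
lemma exists_last_ne_zero {T : Module.End k M} (hT : IsNilpotent T) {v : M} (hv : v ≠ 0) :
    ∃ n : ℕ, (T ^ n) v ≠ 0 ∧ T ((T ^ n) v) = 0 := by
  obtain ⟨N, hN⟩ := hT
  obtain ⟨n, h1, h2⟩ := Nat.exists_not_and_succ_of_not_zero_of_exists
    (p := fun n => (T ^ n) v = 0) (by simpa using hv) ⟨N, by simp [hN]⟩
  exact ⟨n, h1, by rwa [pow_succ', Module.End.mul_apply] at h2⟩

lemma exists_nat_of_lie_e_eq_zero (t : IsSl2Triple h e f) {v : M} (hv : v ≠ 0) {c : k}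
    (hc : ⁅h, v⁆ = c • v) (he : ⁅e, v⁆ = 0) : ∃ n : ℕ, c = n :=
  IsSl2Triple.HasPrimitiveVectorWith.exists_nat (t := t) ⟨hv, hc, he⟩

lemma exists_int_of_lie_h_eq_smul (t : IsSl2Triple h e f) {v : M} (hv : v ≠ 0) {c : k}
    (hc : ⁅h, v⁆ = c • v) : ∃ n : ℤ, c = n := by
  obtain ⟨r, h1, h2⟩ := exists_last_ne_zero (isNilpotent_toEnd_e (k := k) t) hv
  obtain ⟨n, hn⟩ := exists_nat_of_lie_e_eq_zero t h1 (t.lie_h_pow_toEnd_e hc r) h2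
  exact ⟨n - 2 * r, by push_cast; rw [← hn]; ring⟩

/-- `eʳ` is injective on the weight space of weight `-m` if `r ≤ m`. -/
lemma eq_zero_of_pow_toEnd_e_eq_zero (t : IsSl2Triple h e f) {m r : ℕ} (hr : r ≤ m) {v : M}
    (hv : ⁅h, v⁆ = (-m : k) • v) (h0 : (toEnd k L M e ^ r) v = 0) : v = 0 := by
  induction r generalizing v with
  | zero => simpa using h0
  | succ r ih =>
    by_contra hv0
    set w := (toEnd k L M e ^ r) v with hw
    have hw0 : w ≠ 0 := fun hw0 => hv0 (ih (by lia) hv hw0)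
    have hew : ⁅e, w⁆ = 0 := by rwa [pow_succ', Module.End.mul_apply] at h0
    have hhw : ⁅h, w⁆ = (-m + 2 * r : k) • w := t.lie_h_pow_toEnd_e hv r
    obtain ⟨n, hn⟩ := exists_nat_of_lie_e_eq_zero t hw0 hhw hew
    have hnm : n < m := by
      have : n + m = 2 * r := by
        rw [← Nat.cast_inj (R := k)]; push_cast; rw [← hn]; ring
      lia
    -- The Casimir scalar at `w` passes to `v` by the induction hypothesis, then to the lowest
    -- vector `u = fˢv` of weight `-(m + 2s)`, where it equals `(m + 2s)(m + 2s + 2)`. This is too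
    -- large, as `n < m`.
    have hΩw : casimirSl2 k M h e f w = (n * (n + 2) : k) • w := by
      rw [casimirSl2_apply, hew, hhw, hn, lie_smul, hhw, hn, lie_zero]
      module
    have hcomm (s : ℕ) (u : M) : casimirSl2 k M h e f ((toEnd k L M e ^ s) u) =
        (toEnd k L M e ^ s) (casimirSl2 k M h e f u) := by
      induction s with
      | zero => simp
      | succ s ihs =>
        rw [pow_succ', Module.End.mul_apply, Module.End.mul_apply, toEnd_apply_apply,
          casimirSl2_e t, ihs, toEnd_apply_apply]
    have hcommf (s : ℕ) (u : M) : casimirSl2 k M h e f ((toEnd k L M f ^ s) u) =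
        (toEnd k L M f ^ s) (casimirSl2 k M h e f u) := by
      induction s with
      | zero => simp
      | succ s ihs =>
        rw [pow_succ', Module.End.mul_apply, Module.End.mul_apply, toEnd_apply_apply,
          casimirSl2_f t, ihs, toEnd_apply_apply]
    have hΩv : casimirSl2 k M h e f v = (n * (n + 2) : k) • v := by
      rw [← sub_eq_zero]
      refine ih (by lia) ?_ ?_
      · rw [lie_sub, ← casimirSl2_h t, hv, lie_smul, hv, map_smul]
        module
      · rw [map_sub, ← hcomm, map_smul, ← hw, hΩw, sub_self]
    obtain ⟨s, hs0, hs⟩ := exists_last_ne_zero (isNilpotent_toEnd_f (k := k) t) hv0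
    have hhu := t.symm.lie_h_pow_toEnd_e (R := k) (m := v) (μ := (m : k))
      (by rw [neg_lie, hv]; module) s
    have hΩu := hcommf s v
    rw [hΩv, map_smul] at hΩu
    set u := (toEnd k L M f ^ s) v
    rw [neg_lie, neg_eq_iff_eq_neg] at hhu
    have hfe : ⁅f, ⁅e, u⁆⁆ = (m + 2 * s : k) • u := by
      have := sl2_e_f t u
      rw [toEnd_apply_apply] at hs
      rw [hs, lie_zero, hhu] at this
      rw [← sub_eq_add_neg] at this
      exact (sub_eq_zero.mp this.symm)
    rw [casimirSl2_apply, hfe, hhu, lie_neg, lie_smul, hhu, ← sub_eq_zero] at hΩu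
    have key : ((m + 2 * s) * (m + 2 * s + 2) - n * (n + 2) : k) • u = 0 := by
      rw [← hΩu]; module
    rw [smul_eq_zero, or_iff_left hs0, sub_eq_zero] at key
    have key' : (m + 2 * s) * (m + 2 * s + 2) = n * (n + 2) := by exact_mod_cast key
    nlinarith

-- The usual formula for `e fⁿ⁺¹ v`, with the operator `h - n` in place of a scalar: `v` need not be
-- a weight vector, so the formula can be used to prove that `h` is diagonalisable on the kernel of
-- `e`.
omit [CharZero k] [FiniteDimensional k M] in
lemma lie_e_pow_toEnd_f_succ (t : IsSl2Triple h e f) {v : M} (he : ⁅e, v⁆ = 0) (n : ℕ) :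
    ⁅e, (toEnd k L M f ^ (n + 1)) v⁆ =
      (n + 1 : k) • (toEnd k L M f ^ n) (⁅h, v⁆ - (n : k) • v) := by
  have hh (n : ℕ) : ⁅h, (toEnd k L M f ^ n) v⁆ =
      (toEnd k L M f ^ n) (⁅h, v⁆ - (2 * n : k) • v) := by
    induction n with
    | zero => simp
    | succ n ih =>
      rw [pow_succ', Module.End.mul_apply, Module.End.mul_apply, toEnd_apply_apply,
        sl2_h_f (k := k) t, ih]
      simp only [map_sub, map_smul, toEnd_apply_apply, lie_sub, lie_smul]
      push_cast
      module
  induction n with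
  | zero => simp [sl2_e_f t, he]
  | succ n ih =>
    rw [pow_succ', Module.End.mul_apply, toEnd_apply_apply, sl2_e_f t, ih, hh]
    rw [pow_succ' _ n]
    simp only [map_sub, map_smul, Module.End.mul_apply, toEnd_apply_apply, lie_sub, lie_smul]
    push_cast
    module

/-- The vectors killed by `e` are sums of weight vectors whose weights are natural numbers. -/
lemma mem_iSup_highestWeightSpace (t : IsSl2Triple h e f) {v : M} (he : ⁅e, v⁆ = 0) :
    v ∈ ⨆ n : ℕ, highestWeightSpace k M e h n := by
  obtain ⟨N, hN⟩ := isNilpotent_toEnd_f (k := k) (M := M) t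
  -- On the kernel of `e`, `eⁿfⁿ` is a nonzero multiple of `h(h - 1)⋯(h - n + 1)`; each induction
  -- step peels off the last factor.
  suffices H : ∀ (n : ℕ) (v : M), ⁅e, v⁆ = 0 →
      (toEnd k L M e ^ n) ((toEnd k L M f ^ n) v) = 0 →
      v ∈ ⨆ j : Fin n, highestWeightSpace k M e h ((j : ℕ) : k) by
    refine (iSup_le fun j => ?_ : (⨆ j : Fin N, highestWeightSpace k M e h ((j : ℕ) : k)) ≤ _)
      (H N v he (by simp [hN]))
    exact le_iSup (fun n : ℕ => highestWeightSpace k M e h n) j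
  intro n
  induction n with
  | zero => intro v _ h0; simp_all
  | succ n ih =>
    intro v he h0
    set T : Module.End k M := toEnd k L M h - (n : k) • LinearMap.id
    have hTe (u : M) (hu : ⁅e, u⁆ = 0) : ⁅e, T u⁆ = 0 := by
      simp [T, lie_h_mem_ker_e t hu, hu]
    have h1 := ih (T v) (hTe v he) (by
      rw [pow_succ, Module.End.mul_apply, toEnd_apply_apply, lie_e_pow_toEnd_f_succ t he,
        map_smul, smul_eq_zero] at h0
      exact h0.resolve_left (Nat.cast_add_one_ne_zero n))
    set W := ⨆ j : Fin n, highestWeightSpace k M e h ((j : ℕ) : k)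
    -- Only weights below `n` occur in `W`, so `h - n` is invertible on it.
    have hW : W ≤ W.map T := by
      refine iSup_le fun j u hu => ?_
      have hne : ((j : ℕ) : k) - n ≠ 0 := by
        rw [sub_ne_zero, Ne, Nat.cast_inj]; exact j.2.ne
      refine ⟨(((j : ℕ) : k) - n)⁻¹ • u, Submodule.smul_mem _ _
        (le_iSup (fun j : Fin n => highestWeightSpace k M e h ((j : ℕ) : k)) j hu), ?_⟩
      have := (mem_highestWeightSpace.mp hu).2
      simp only [T, map_smul, LinearMap.sub_apply, toEnd_apply_apply, this, LinearMap.smul_apply,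
        LinearMap.id_apply, ← sub_smul, smul_smul, inv_mul_cancel₀ hne, one_smul]
    have hWe (u : M) (hu : u ∈ W) : ⁅e, u⁆ = 0 :=
      (iSup_le fun j => inf_le_left : W ≤ LinearMap.ker (toEnd k L M e)) hu
    obtain ⟨u, hu, huv⟩ := hW h1
    have hvu : v - u ∈ highestWeightSpace k M e h (n : k) := by
      rw [mem_highestWeightSpace]
      refine ⟨by rw [lie_sub, he, hWe u hu, sub_self], ?_⟩
      have : T (v - u) = 0 := by rw [map_sub, huv, sub_self]
      simpa [T, sub_eq_zero] using this
    rw [← sub_add_cancel v u]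
    refine add_mem ?_ ?_
    · exact le_iSup (fun j : Fin (n + 1) => highestWeightSpace k M e h ((j : ℕ) : k))
        (Fin.last n) (by simpa using hvu)
    · exact (iSup_le fun j => le_iSup
        (fun j : Fin (n + 1) => highestWeightSpace k M e h ((j : ℕ) : k)) j.castSucc :
          W ≤ _) hu

/-- The sum of the highest weight spaces of weight at least `m`. -/
def highestWeightGE (k M : Type*) [Field k] {L : Type*} [LieRing L] [LieAlgebra k L]
    [AddCommGroup M] [Module k M] [LieRingModule L M] [LieModule k L M] (e h : L) (m : ℕ) :
    Submodule k M :=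
  ⨆ n : {n : ℕ // m ≤ n}, highestWeightSpace k M e h (n : ℕ)

omit [CharZero k] [FiniteDimensional k M] in
lemma highestWeightSpace_le_GE {m n : ℕ} (hmn : m ≤ n) :
    highestWeightSpace k M e h n ≤ highestWeightGE k M e h m :=
  le_iSup (fun n : {n : ℕ // m ≤ n} => highestWeightSpace k M e h (n : ℕ)) ⟨n, hmn⟩

omit [CharZero k] [FiniteDimensional k M] in
lemma highestWeightGE_le_iff {m : ℕ} {W : Submodule k M} :
    highestWeightGE k M e h m ≤ W ↔ ∀ n, m ≤ n → highestWeightSpace k M e h n ≤ W := by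
  simp [highestWeightGE]

omit [CharZero k] [FiniteDimensional k M] in
lemma highestWeightGE_antitone {m n : ℕ} (hmn : m ≤ n) :
    highestWeightGE k M e h n ≤ highestWeightGE k M e h m :=
  highestWeightGE_le_iff.mpr fun _ hj => highestWeightSpace_le_GE (hmn.trans hj)

omit [CharZero k] [FiniteDimensional k M] in
lemma highestWeightGE_le (m : ℕ) :
    highestWeightGE k M e h m ≤ highestWeightSpace k M e h m ⊔ highestWeightGE k M e h (m + 1) := by
  refine highestWeightGE_le_iff.mpr fun n hn => ?_
  rcases hn.eq_or_lt with rfl | hn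
  · exact le_sup_left
  · exact (highestWeightSpace_le_GE hn).trans le_sup_right

lemma exists_highestWeightSpace_eq_bot :
    ∃ N : ℕ, ∀ n, N ≤ n → highestWeightSpace k M e h (n : k) = ⊥ := by
  have hfin : {c : k | (toEnd k L M h).HasEigenvalue c}.Finite :=
    Module.End.finite_hasEigenvalue _
  have hfin' := hfin.preimage (Nat.cast_injective (R := k)).injOn
  obtain ⟨N, hN⟩ := hfin'.bddAbove
  refine ⟨N + 1, fun n hn => ?_⟩
  rw [eq_bot_iff]
  intro v hv
  by_contra hv0
  have : n ≤ N := hN (Module.End.hasEigenvalue_of_hasEigenvector (x := v)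
    ⟨Module.End.mem_eigenspace_iff.mpr (mem_highestWeightSpace.mp hv).2, by simpa using hv0⟩)
  lia

lemma exists_highestWeightGE_eq_bot : ∃ N : ℕ, highestWeightGE k M e h N = ⊥ := by
  obtain ⟨N, hN⟩ := exists_highestWeightSpace_eq_bot (k := k) (M := M) (e := e) (h := h)
  exact ⟨N, eq_bot_iff.mpr (highestWeightGE_le_iff.mpr fun n hn => (hN n hn).le)⟩

/-- A vector killed by `e` which lies in the image of `e` has only positive weights. -/
lemma lie_e_mem_highestWeightGE_one (t : IsSl2Triple h e f) {u : M} (hu : ⁅e, ⁅e, u⁆⁆ = 0) :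
    ⁅e, u⁆ ∈ highestWeightGE k M e h 1 := by
  have h0 : ⁅e, u⁆ ∈ highestWeightGE k M e h 0 :=
    (iSup_le fun n => highestWeightSpace_le_GE (Nat.zero_le n) :
      (⨆ n : ℕ, highestWeightSpace k M e h n) ≤ _) (mem_iSup_highestWeightSpace t hu)
  obtain ⟨v₀, hv₀, v₁, hv₁, hv⟩ := Submodule.mem_sup.mp (highestWeightGE_le 0 h0)
  have him : highestWeightGE k M e h 1 ≤ LinearMap.range (toEnd k L M e) := by
    refine highestWeightGE_le_iff.mpr fun n hn v hv => ?_
    obtain ⟨h1, h2⟩ := mem_highestWeightSpace.mp hv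
    have hn0 : (n : k) ≠ 0 := by rw [Nat.cast_ne_zero]; lia
    refine ⟨(n : k)⁻¹ • ⁅f, v⁆, ?_⟩
    rw [map_smul, toEnd_apply_apply, sl2_e_f t, h1, h2, lie_zero, zero_add, smul_smul,
      inv_mul_cancel₀ hn0, one_smul]
  obtain ⟨u₁, rfl⟩ := him hv₁
  obtain ⟨he0, hh0⟩ := mem_highestWeightSpace.mp hv₀
  rw [Nat.cast_zero, zero_smul] at hh0
  -- It remains to kill the weight zero part `v₀ = e w`. Modulo the kernel of `e`, `w` can be
  -- replaced by a vector of weight `-2`; `e²` kills it, so it vanishes.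
  set w := u - u₁
  have hw : ⁅e, w⁆ = v₀ := by
    simp only [w, lie_sub, ← hv, toEnd_apply_apply]; abel
  -- the operator `h + 2` is bijective on the kernel of `e`
  let K := LinearMap.ker (toEnd k L M e)
  let T : Module.End k M := toEnd k L M h + (2 : k) • LinearMap.id
  have hT : ∀ x ∈ K, T x ∈ K := fun x hx => by
    have hx' : ⁅e, x⁆ = 0 := hx
    simp [K, T, hx', lie_h_mem_ker_e t hx']
  have hinj : Function.Injective (T.restrict hT) := by
    rw [injective_iff_map_eq_zero]
    rintro ⟨x, hx⟩ hTx
    have hTx' : ⁅h, x⁆ + (2 : k) • x = 0 := congrArg Subtype.val hTx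
    by_contra hx0
    obtain ⟨n, hn⟩ := exists_nat_of_lie_e_eq_zero (c := (-2 : k)) t
      (fun h => hx0 (Subtype.ext h)) (by rw [neg_smul]; exact eq_neg_of_add_eq_zero_left hTx') hx
    have : ((n + 2 : ℕ) : k) = 0 := by push_cast; rw [← hn]; ring
    exact absurd (Nat.cast_eq_zero.mp this) (by lia)
  have hTw : T w ∈ K := by
    have := sl2_h_e (k := k) t w
    rw [hw, hh0] at this
    simp [K, T, hw, ← this]
  obtain ⟨⟨y, hy⟩, hyw⟩ := LinearMap.surjective_of_injective hinj ⟨T w, hTw⟩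
  have hyw' : T y = T w := congrArg Subtype.val hyw
  have hz : ⁅h, w - y⁆ = (-(2 : ℕ) : k) • (w - y) := by
    have : T (w - y) = 0 := by rw [map_sub, hyw', sub_self]
    rw [Nat.cast_ofNat, neg_smul]
    exact eq_neg_of_add_eq_zero_left this
  have hey : ⁅e, y⁆ = 0 := hy
  have hz0 : w - y = 0 := eq_zero_of_pow_toEnd_e_eq_zero t le_rfl hz (by
    simp [pow_two, hw, hey, he0])
  have : v₀ = 0 := by rw [← hw, sub_eq_zero.mp hz0, hey]
  rw [← hv, this, zero_add]
  exact hv₁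

end Sl2

/-! ### Representations of `𝔰𝔩₃` and the key surjectivity statement. -/

section Sl3

variable {k : Type*} [Field k] {L : Type*} [LieRing L] [LieAlgebra k L]
  {M : Type*} [AddCommGroup M] [Module k M] [LieRingModule L M] [LieModule k L M]

/-- The commutation relations of `𝔰𝔩₃` between `p = E₁₂`, `q = E₂₃`, `e = E₁₃`, their transposes
`p'`, `q'`, `f` and the coroots `h₁`, `h₂`, `h = h₁ + h₂`. -/
structure Sl3System (p q e p' q' f h₁ h₂ h : L) : Prop where
  triple₁ : IsSl2Triple h₁ p p'
  triple₂ : IsSl2Triple h₂ q q'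
  triple : IsSl2Triple h e f
  add : h₁ + h₂ = h
  p_q : ⁅p, q⁆ = e
  e_p : ⁅e, p⁆ = 0
  e_q : ⁅e, q⁆ = 0
  e_p' : ⁅e, p'⁆ = -q
  e_q' : ⁅e, q'⁆ = p
  p_f : ⁅p, f⁆ = -q'
  q_f : ⁅q, f⁆ = p'
  p_q' : ⁅p, q'⁆ = 0
  q_p' : ⁅q, p'⁆ = 0
  h₁_q : ⁅h₁, q⁆ = -q
  h₁_q' : ⁅h₁, q'⁆ = q'
  h₂_p : ⁅h₂, p⁆ = -p
  h₂_p' : ⁅h₂, p'⁆ = p'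
  h₁_h₂ : ⁅h₁, h₂⁆ = 0

variable {p q e p' q' f h₁ h₂ h : L}

/-- The symmetry of the Dynkin diagram. -/
lemma Sl3System.symm (s : Sl3System p q e p' q' f h₁ h₂ h) :
    Sl3System q p (-e) q' p' (-f) h₂ h₁ h where
  triple₁ := s.triple₂
  triple₂ := s.triple₁
  triple :=
    { h_ne_zero := s.triple.h_ne_zero
      lie_e_f := by simp [s.triple.lie_e_f]
      lie_h_e_nsmul := by simp [s.triple.lie_h_e_nsmul]
      lie_h_f_nsmul := by simp [s.triple.lie_h_f_nsmul] }
  add := by rw [add_comm, s.add]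
  p_q := by rw [← lie_skew, s.p_q]
  e_p := by simp [s.e_q]
  e_q := by simp [s.e_p]
  e_p' := by simp [s.e_q']
  e_q' := by simp [s.e_p']
  p_f := by simp [s.q_f]
  q_f := by simp [s.p_f]
  p_q' := s.q_p'
  q_p' := s.p_q'
  h₁_q := s.h₂_p
  h₁_q' := s.h₂_p'
  h₂_p := s.h₁_q
  h₂_p' := s.h₁_q'
  h₁_h₂ := by rw [← lie_skew, s.h₁_h₂, neg_zero]

/-- A simultaneous eigenvector for `h₁`, `h₂` and `p'p + q'q` which is killed by `e`. -/
structure IsJointEigenvector (p q e p' q' h₁ h₂ : L) (v : M) (a b c : k) : Prop where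
  lie_e : ⁅e, v⁆ = 0
  lie_h₁ : ⁅h₁, v⁆ = a • v
  lie_h₂ : ⁅h₂, v⁆ = b • v
  op : ⁅p', ⁅p, v⁆⁆ + ⁅q', ⁅q, v⁆⁆ = c • v

omit [LieAlgebra k L] [LieModule k L M] in
lemma IsJointEigenvector.symm {v : M} {a b c : k}
    (J : IsJointEigenvector p q e p' q' h₁ h₂ v a b c) :
    IsJointEigenvector q p (-e) q' p' h₂ h₁ v b a c where
  lie_e := by simp [J.lie_e]
  lie_h₁ := J.lie_h₂
  lie_h₂ := J.lie_h₁
  op := by rw [add_comm, J.op]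

/-- On the kernel of `e` the operators `p` and `q` commute, and `[p, q'] = 0`. Hence moving `p` past
`p'p + q'q` only produces the term `h₁ p v = (a + 2) p v`. -/
lemma IsJointEigenvector.lie_p (s : Sl3System p q e p' q' f h₁ h₂ h) {v : M} {a b c : k}
    (J : IsJointEigenvector p q e p' q' h₁ h₂ v a b c) :
    IsJointEigenvector p q e p' q' h₁ h₂ ⁅p, v⁆ (a + 2) (b - 1) (c - a - 2) where
  lie_e := by rw [leibniz_lie, s.e_p, J.lie_e]; simp
  lie_h₁ := by rw [sl2_h_e (k := k) s.triple₁, J.lie_h₁, lie_smul]; module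
  lie_h₂ := by rw [leibniz_lie, s.h₂_p, J.lie_h₂, lie_smul, neg_lie]; module
  op := by
    have hqp : ⁅q, ⁅p, v⁆⁆ = ⁅p, ⁅q, v⁆⁆ := by
      rw [leibniz_lie p, s.p_q, J.lie_e, zero_add]
    have h1 : ⁅p, ⁅p', ⁅p, v⁆⁆⁆ = ⁅p', ⁅p, ⁅p, v⁆⁆⁆ + (a + 2) • ⁅p, v⁆ := by
      rw [sl2_e_f s.triple₁, sl2_h_e (k := k) s.triple₁, J.lie_h₁, lie_smul]; module
    have h2 : ⁅p, ⁅q', ⁅q, v⁆⁆⁆ = ⁅q', ⁅p, ⁅q, v⁆⁆⁆ := by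
      rw [leibniz_lie p, s.p_q', zero_lie, zero_add]
    have h3 := congrArg (fun x => ⁅p, x⁆) J.op
    simp only [lie_add, h1, h2, lie_smul] at h3
    rw [hqp, ← sub_eq_zero]
    rw [← sub_eq_zero] at h3
    rw [← h3]
    module

lemma IsJointEigenvector.pow_p (s : Sl3System p q e p' q' f h₁ h₂ h) {v : M} {a b c : k}
    (J : IsJointEigenvector p q e p' q' h₁ h₂ v a b c) (r : ℕ) :
    IsJointEigenvector p q e p' q' h₁ h₂ ((toEnd k L M p ^ r) v) (a + 2 * r) (b - r)
      (c - r * (a + r + 1)) := by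
  induction r with
  | zero => simpa using J
  | succ r ih =>
    have := ih.lie_p s
    rw [pow_succ', Module.End.mul_apply, toEnd_apply_apply]
    convert this using 1 <;> push_cast <;> ring

variable [CharZero k] [FiniteDimensional k M]

/-- One of the two simple root vectors leads upwards from a joint eigenvector, unless it is a
highest weight vector. -/
lemma IsJointEigenvector.exists_up_of_lie_p_ne_zero (s : Sl3System p q e p' q' f h₁ h₂ h) {v : M}
    {a b : ℤ} {c : k} (J : IsJointEigenvector p q e p' q' h₁ h₂ v (a : k) (b : k) c)
    (hv : v ≠ 0) (h0 : ⁅p, v⁆ ≠ 0 ∨ a < 0) :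
    ∃ (w : M) (a' b' : ℤ) (c' : k) (n : ℕ), w ≠ 0 ∧
      IsJointEigenvector p q e p' q' h₁ h₂ w (a' : k) (b' : k) c' ∧ a + b < a' + b' ∧
      c = c' + n := by
  rcases lt_or_ge a 0 with ha | ha
  -- A single step would change `c` by `a + 2`, possibly negative. Reflecting the `h₁`-weight from
  -- `-r` to `r` by `pʳ` instead lowers `c` by `r(a + r + 1) = r`.
  · obtain ⟨r, rfl⟩ : ∃ r : ℕ, a = -r := ⟨a.natAbs, by lia⟩
    refine ⟨_, -r + 2 * r, b - r, _, r, ?_, by simpa using J.pow_p s r, by lia, by ring⟩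
    intro hw
    exact hv (eq_zero_of_pow_toEnd_e_eq_zero s.triple₁ le_rfl (by simpa using J.lie_h₁) hw)
  · obtain ⟨r, rfl⟩ := Int.eq_ofNat_of_zero_le ha
    exact ⟨_, r + 2, b - 1, _, r + 2, h0.resolve_right (by lia), by simpa using J.lie_p s, by lia,
      by push_cast; ring⟩

/-- Each move upwards raises the `h`-weight `a + b` and lowers `c` by a natural number. The weights
are bounded, so the process ends at a vector killed by `p` and `q`, where `c = 0`. -/
lemma IsJointEigenvector.exists_nat (s : Sl3System p q e p' q' f h₁ h₂ h) (N : ℕ)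
    (hN : ∀ n, N ≤ n → highestWeightSpace k M e h (n : k) = ⊥) {v : M} (hv : v ≠ 0)
    {a b : ℤ} {c : k} (J : IsJointEigenvector p q e p' q' h₁ h₂ v (a : k) (b : k) c)
    (hab : 0 ≤ a + b) : ∃ n : ℕ, c = n := by
  obtain ⟨m, hm⟩ : ∃ m : ℕ, (N : ℤ) - (a + b) ≤ m := ⟨_, Int.self_le_toNat _⟩
  induction m generalizing v a b c with
  | zero =>
    refine absurd ?_ hv
    have hmem : v ∈ highestWeightSpace k M e h (((a + b).toNat : ℕ) : k) := by
      rw [mem_highestWeightSpace]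
      refine ⟨J.lie_e, ?_⟩
      have : (((a + b).toNat : ℕ) : k) = a + b := by
        rw [← Int.cast_natCast, Int.toNat_of_nonneg hab, Int.cast_add]
      rw [this, ← s.add, add_lie, J.lie_h₁, J.lie_h₂, add_smul]
    rw [hN _ (by lia)] at hmem
    simpa using hmem
  | succ m ih =>
    have step (H : ∃ (w : M) (a' b' : ℤ) (c' : k) (n : ℕ), w ≠ 0 ∧
        IsJointEigenvector p q e p' q' h₁ h₂ w (a' : k) (b' : k) c' ∧ a + b < a' + b' ∧
        c = c' + n) : ∃ n : ℕ, c = n := by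
      obtain ⟨w, a', b', c', n, hw, J', hlt, rfl⟩ := H
      obtain ⟨n', rfl⟩ := ih hw J' (by lia) (by lia)
      exact ⟨n' + n, by push_cast; ring⟩
    by_cases hp : ⁅p, v⁆ = 0
    · by_cases hq : ⁅q, v⁆ = 0
      · have := J.op
        rw [hp, hq, lie_zero, lie_zero, add_zero, eq_comm, smul_eq_zero, or_iff_left hv] at this
        exact ⟨0, by simpa using this⟩
      · obtain ⟨w, a', b', c', n, hw, J', hlt, hc⟩ :=
          J.symm.exists_up_of_lie_p_ne_zero s.symm hv (.inl hq)
        exact step ⟨w, b', a', c', n, hw, by simpa using J'.symm, by lia, hc⟩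
    · exact step (J.exists_up_of_lie_p_ne_zero s hv (.inl hp))

/-- The operator `p'p + q'q`. -/
def loweringRaising (k M : Type*) [Field k] {L : Type*} [LieRing L] [LieAlgebra k L]
    [AddCommGroup M] [Module k M] [LieRingModule L M] [LieModule k L M] (p q p' q' : L) :
    Module.End k M :=
  toEnd k L M p' * toEnd k L M p + toEnd k L M q' * toEnd k L M q

omit [CharZero k] [FiniteDimensional k M] in
lemma loweringRaising_apply (v : M) :
    loweringRaising k M p q p' q' v = ⁅p', ⁅p, v⁆⁆ + ⁅q', ⁅q, v⁆⁆ := rfl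

omit [CharZero k] [FiniteDimensional k M] in
lemma Sl3System.lie_h₁_loweringRaising (s : Sl3System p q e p' q' f h₁ h₂ h) (v : M) :
    ⁅h₁, loweringRaising k M p q p' q' v⁆ = loweringRaising k M p q p' q' ⁅h₁, v⁆ := by
  have h1 : ∀ u : M, ⁅h₁, ⁅q, u⁆⁆ = ⁅q, ⁅h₁, u⁆⁆ - ⁅q, u⁆ := fun u => by
    rw [leibniz_lie, s.h₁_q, neg_lie]; abel
  have h2 : ∀ u : M, ⁅h₁, ⁅q', u⁆⁆ = ⁅q', ⁅h₁, u⁆⁆ + ⁅q', u⁆ := fun u => by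
    rw [leibniz_lie, s.h₁_q']; abel
  simp only [loweringRaising_apply, lie_add, h1, h2, sl2_h_e (k := k) s.triple₁,
    sl2_h_f (k := k) s.triple₁, lie_sub, lie_smul]
  abel

-- Since `[e, p'] = -q` and `[e, q'] = p`, applying `e` leaves `(pq - qp) v = e v = 0`.
omit [CharZero k] [FiniteDimensional k M] in
lemma Sl3System.loweringRaising_mem (s : Sl3System p q e p' q' f h₁ h₂ h) {c : k} {v : M}
    (hv : v ∈ highestWeightSpace k M e h c) :
    loweringRaising k M p q p' q' v ∈ highestWeightSpace k M e h c := by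
  obtain ⟨he, hh⟩ := mem_highestWeightSpace.mp hv
  rw [mem_highestWeightSpace]
  constructor
  · have hp : ⁅e, ⁅p, v⁆⁆ = 0 := by rw [leibniz_lie, s.e_p, he]; simp
    have hq : ⁅e, ⁅q, v⁆⁆ = 0 := by rw [leibniz_lie, s.e_q, he]; simp
    have hqp : ⁅p, ⁅q, v⁆⁆ = ⁅q, ⁅p, v⁆⁆ := by
      rw [leibniz_lie p, s.p_q, he, zero_add]
    rw [loweringRaising_apply, lie_add, leibniz_lie e, leibniz_lie e q', s.e_p', s.e_q', hp, hq,
      neg_lie, hqp]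
    simp
  · have h1 := s.lie_h₁_loweringRaising (k := k) v
    have h2 := s.symm.lie_h₁_loweringRaising (k := k) v
    rw [loweringRaising_apply, loweringRaising_apply, add_comm, add_comm ⁅q', _⁆,
      ← loweringRaising_apply (k := k), ← loweringRaising_apply (k := k)] at h2
    rw [← s.add, add_lie, h1, h2, ← map_add, ← add_lie, s.add, hh, map_smul]

variable [IsAlgClosed k]

/-- The kernel in question is stable under `h₁`. An `h₁`-eigenvector in it would be a joint
eigenvector with the negative eigenvalue `-c`, contradicting `IsJointEigenvector.exists_nat`. -/
lemma Sl3System.loweringRaising_add_injOn (s : Sl3System p q e p' q' f h₁ h₂ h) (i c : ℕ)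
    (hc : c ≠ 0) {v : M} (hv : v ∈ highestWeightSpace k M e h (i : k))
    (h0 : loweringRaising k M p q p' q' v + (c : k) • v = 0) : v = 0 := by
  let S := loweringRaising k M p q p' q'
  let K : Submodule k M := highestWeightSpace k M e h (i : k) ⊓
    LinearMap.ker (S + (c : k) • LinearMap.id)
  have hh₁e : ⁅h₁, e⁆ = e := by
    rw [← s.p_q, leibniz_lie, s.triple₁.lie_h_e_nsmul, s.h₁_q, s.p_q]
    simp [two_smul, s.p_q]
  have hh₁h : ⁅h, h₁⁆ = 0 := by
    rw [← s.add, add_lie, lie_self, zero_add, ← lie_skew, s.h₁_h₂, neg_zero]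
  have hK : ∀ x ∈ K, toEnd k L M h₁ x ∈ K := by
    rintro x ⟨hx, hx'⟩
    obtain ⟨hxe, hxh⟩ := mem_highestWeightSpace.mp hx
    refine ⟨mem_highestWeightSpace.mpr ⟨?_, ?_⟩, ?_⟩
    · rw [toEnd_apply_apply, leibniz_lie, hxe, ← lie_skew, hh₁e, neg_lie, hxe]; simp
    · rw [toEnd_apply_apply, leibniz_lie, hh₁h, hxh, zero_lie, zero_add, lie_smul]
    · have hx0 : S x + (c : k) • x = 0 := hx'
      change S ⁅h₁, x⁆ + (c : k) • ⁅h₁, x⁆ = 0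
      rw [← s.lie_h₁_loweringRaising, ← lie_smul, ← lie_add, hx0, lie_zero]
  by_contra hv0
  have : Nontrivial K := ⟨⟨v, hv, h0⟩, 0, fun h => hv0 (congrArg Subtype.val h)⟩
  obtain ⟨a, ha⟩ := Module.End.exists_eigenvalue ((toEnd k L M h₁).restrict hK)
  obtain ⟨⟨x, hx, hxS⟩, hxa, hx0⟩ := ha.exists_hasEigenvector
  have hxa' : ⁅h₁, x⁆ = a • x := congrArg Subtype.val (Module.End.mem_eigenspace_iff.mp hxa)
  have hx0' : x ≠ 0 := fun h => hx0 (Subtype.ext h)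
  obtain ⟨a, rfl⟩ := exists_int_of_lie_h_eq_smul s.triple₁ hx0' hxa'
  obtain ⟨hxe, hxh⟩ := mem_highestWeightSpace.mp hx
  obtain ⟨N, hN⟩ := exists_highestWeightSpace_eq_bot (k := k) (M := M) (e := e) (h := h)
  obtain ⟨n, hn⟩ := IsJointEigenvector.exists_nat (c := (-c : k)) (a := a) (b := i - a) s N hN hx0'
    ⟨hxe, hxa', by
      rw [← s.add, add_lie, hxa'] at hxh
      rw [eq_sub_of_add_eq' hxh]
      push_cast
      module, by
      rw [neg_smul]; exact eq_neg_of_add_eq_zero_left hxS⟩ (by lia)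
  have : ((n + c : ℕ) : k) = 0 := by push_cast; rw [← hn]; ring
  exact absurd (Nat.cast_eq_zero.mp this) (by lia)

/-- In a finite-dimensional `𝔰𝔩₃`-module the vectors of weight `i + 1` killed by the highest root
vector are obtained from those of weight `i` by the two simple root vectors. -/
theorem Sl3System.exists_lie_add_lie_eq (s : Sl3System p q e p' q' f h₁ h₂ h) (i : ℕ) {w : M}
    (hw : w ∈ highestWeightSpace k M e h (i + 1 : k)) :
    ∃ u₁ ∈ highestWeightSpace k M e h (i : k), ∃ u₂ ∈ highestWeightSpace k M e h (i : k),
      w = ⁅p, u₁⁆ + ⁅q, u₂⁆ := by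
  let V := highestWeightSpace k M e h (i + 1 : k)
  let T : Module.End k M := loweringRaising k M p q p' q' + (i + 2 : k) • LinearMap.id
  have hT : ∀ x ∈ V, T x ∈ V := fun x hx =>
    add_mem (s.loweringRaising_mem hx) (Submodule.smul_mem _ _ hx)
  have hinj : Function.Injective (T.restrict hT) := by
    rw [injective_iff_map_eq_zero]
    rintro ⟨x, hx⟩ hTx
    have hTx' : loweringRaising k M p q p' q' x + (i + 2 : k) • x = 0 :=
      congrArg Subtype.val hTx
    exact Subtype.ext (s.loweringRaising_add_injOn (i + 1) (i + 2) (by lia) (by simpa using hx)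
      (by simpa using hTx'))
  obtain ⟨⟨v, hv⟩, hvw⟩ := LinearMap.surjective_of_injective hinj ⟨w, hw⟩
  have hvw' : loweringRaising k M p q p' q' v + (i + 2 : k) • v = w := congrArg Subtype.val hvw
  obtain ⟨he, hh⟩ := mem_highestWeightSpace.mp hv
  have hi1 : (i + 1 : k) ≠ 0 := Nat.cast_add_one_ne_zero i
  have hp : ⁅e, ⁅p, v⁆⁆ = 0 := by rw [leibniz_lie, s.e_p, he]; simp
  have hq : ⁅e, ⁅q, v⁆⁆ = 0 := by rw [leibniz_lie, s.e_q, he]; simp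
  have hpq : ⁅p, ⁅q, v⁆⁆ = ⁅q, ⁅p, v⁆⁆ := by
    rw [leibniz_lie p, s.p_q, he, zero_add]
  have hhp : ⁅h, ⁅p, v⁆⁆ = (i + 2 : k) • ⁅p, v⁆ := by
    have : ⁅h, p⁆ = p := by
      rw [← s.add, add_lie, s.triple₁.lie_h_e_nsmul, s.h₂_p, two_smul]; abel
    rw [leibniz_lie, this, hh, lie_smul]; module
  have hhq : ⁅h, ⁅q, v⁆⁆ = (i + 2 : k) • ⁅q, v⁆ := by
    have : ⁅h, q⁆ = q := by
      rw [← s.add, add_lie, s.triple₂.lie_h_e_nsmul, s.h₁_q, two_smul]; abel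
    rw [leibniz_lie, this, hh, lie_smul]; module
  have hhp' : ⁅h, ⁅p', v⁆⁆ = (i : k) • ⁅p', v⁆ := by
    have : ⁅h, p'⁆ = -p' := by
      rw [← s.add, add_lie, s.triple₁.lie_h_f_nsmul, s.h₂_p', two_smul]; abel
    rw [leibniz_lie, this, hh, lie_smul, neg_lie]; module
  have hhq' : ⁅h, ⁅q', v⁆⁆ = (i : k) • ⁅q', v⁆ := by
    have : ⁅h, q'⁆ = -q' := by
      rw [← s.add, add_lie, s.triple₂.lie_h_f_nsmul, s.h₁_q', two_smul]; abel
    rw [leibniz_lie, this, hh, lie_smul, neg_lie]; module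
  have hep' : ⁅e, ⁅p', v⁆⁆ = -⁅q, v⁆ := by
    rw [leibniz_lie, s.e_p', he, neg_lie, lie_zero, add_zero]
  have heq' : ⁅e, ⁅q', v⁆⁆ = ⁅p, v⁆ := by
    rw [leibniz_lie, s.e_q', he, lie_zero, add_zero]
  have hpp' : ⁅p, ⁅p', v⁆⁆ = ⁅p', ⁅p, v⁆⁆ + ⁅h₁, v⁆ := sl2_e_f s.triple₁ v
  have hqq' : ⁅q, ⁅q', v⁆⁆ = ⁅q', ⁅q, v⁆⁆ + ⁅h₂, v⁆ := sl2_e_f s.triple₂ v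
  have hh' : ⁅h₁, v⁆ + ⁅h₂, v⁆ = (i + 1 : k) • v := by rw [← add_lie, s.add, hh]
  -- The terms `f q v` and `f p v` cancel `e p' v = -q v` and `e q' v = p v`, because `e f` acts on
  -- `p v` and `q v` as `h = i + 2`. In `p u₁ + q u₂` one gets `(i + 2)(S + i + 1) v - S v = (i +
  -- 1)(S + i + 2) v`, where `S = p'p + q'q`.
  refine ⟨(i + 1 : k)⁻¹ • ((i + 2 : k) • ⁅p', v⁆ + ⁅f, ⁅q, v⁆⁆), Submodule.smul_mem _ _ ?_,
    (i + 1 : k)⁻¹ • ((i + 2 : k) • ⁅q', v⁆ - ⁅f, ⁅p, v⁆⁆), Submodule.smul_mem _ _ ?_, ?_⟩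
  · rw [mem_highestWeightSpace]
    constructor
    · rw [lie_add, lie_smul, hep', sl2_e_f s.triple, hq, hhq, lie_zero]; module
    · rw [lie_add, lie_smul, hhp', sl2_h_f (k := k) s.triple, hhq, lie_smul]; module
  · rw [mem_highestWeightSpace]
    constructor
    · rw [lie_sub, lie_smul, heq', sl2_e_f s.triple, hp, hhp, lie_zero]; module
    · rw [lie_sub, lie_smul, hhq', sl2_h_f (k := k) s.triple, hhp, lie_smul]; module
  · rw [lie_smul, lie_smul, ← smul_add, eq_inv_smul_iff₀ hi1, ← hvw', lie_add, lie_sub, lie_smul,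
      lie_smul, hpp', hqq', leibniz_lie p f, leibniz_lie q f, s.p_f, s.q_f, hpq, neg_lie,
      loweringRaising_apply, eq_sub_of_add_eq hh']
    module

end Sl3

/-! ### Exponentials and the adjoint group act by Lie algebra automorphisms. -/

section Exp

variable {k : Type*} [Field k] [CharZero k] {L : Type*} [LieRing L] [LieAlgebra k L]

/-- The exponential of a nilpotent `ad x` is an automorphism. -/
lemma exists_lieEquiv_eq_sum {x : L} (hx : IsNilpotent (ad k L x)) :
    ∃ Θ : L ≃ₗ⁅k⁆ L, ∀ n, ad k L x ^ n = 0 →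
      (Θ : L →ₗ[k] L) = ∑ i ∈ Finset.range n, (i.factorial : k)⁻¹ • (ad k L x) ^ i := by
  -- `LieDerivation.exp` is built from rational coefficients, so a `ℚ`-structure compatible with `k`
  -- is put on `L`.
  let _ : Module ℚ L := Module.compHom L (algebraMap ℚ k)
  have _ : IsScalarTower ℚ k L := ⟨fun a b c => by
    rw [Algebra.smul_def, mul_smul]; rfl⟩
  let _ : LieAlgebra ℚ L :=
    { lie_smul := fun a x y => lie_smul (algebraMap ℚ k a) x y }
  have hD : (LieDerivation.ad k L x).toLinearMap = ad k L x := by simp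
  have hx' : IsNilpotent (LieDerivation.ad k L x).toLinearMap := by rwa [hD]
  refine ⟨LieDerivation.exp (LieDerivation.ad k L x) hx', fun n hn => ?_⟩
  refine (LieDerivation.exp_apply (LieDerivation.ad k L x) hx').trans ?_
  rw [hD, IsNilpotent.exp_eq_sum hn]
  refine Finset.sum_congr rfl fun i _ => ?_
  ext v
  simp only [LinearMap.smul_apply]
  rw [← algebraMap_smul k]
  simp

/-- The elements of the adjoint group are automorphisms. -/
lemma exists_lieEquiv_of_mem_adjointGroup {g : L ≃ₗ[k] L} (hg : g ∈ adjointGroup k L) :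
    ∃ Θ : L ≃ₗ⁅k⁆ L, ∀ v, Θ v = g v := by
  induction hg using Subgroup.closure_induction with
  | mem g hg =>
    obtain ⟨x, hx, hgx⟩ := hg
    obtain ⟨Θ, hΘ⟩ := exists_lieEquiv_eq_sum hx
    refine ⟨Θ, fun v => ?_⟩
    have := (hΘ _ (pow_nilpotencyClass hx)).trans hgx.symm
    exact LinearMap.congr_fun this v
  | one => exact ⟨LieEquiv.refl, fun v => rfl⟩
  | mul g₁ g₂ _ _ ih₁ ih₂ =>
    obtain ⟨Θ₁, h₁⟩ := ih₁
    obtain ⟨Θ₂, h₂⟩ := ih₂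
    exact ⟨Θ₂.trans Θ₁, fun v => by simp [h₁, h₂]⟩
  | inv g _ ih =>
    obtain ⟨Θ, hΘ⟩ := ih
    refine ⟨Θ.symm, fun v => ?_⟩
    apply Θ.injective
    exact (Θ.apply_symm_apply v).trans ((g.apply_symm_apply v).symm.trans (hΘ _).symm)

lemma exists_lieEquiv_of_mem_adjointOrbit {x y z : L} (hy : y ∈ adjointOrbit k x)
    (hz : z ∈ adjointOrbit k x) : ∃ Θ : L ≃ₗ⁅k⁆ L, Θ y = z := by
  obtain ⟨g₁, hg₁, rfl⟩ := hy
  obtain ⟨g₂, hg₂, rfl⟩ := hz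
  obtain ⟨Θ₁, h₁⟩ := exists_lieEquiv_of_mem_adjointGroup hg₁
  obtain ⟨Θ₂, h₂⟩ := exists_lieEquiv_of_mem_adjointGroup hg₂
  exact ⟨Θ₁.symm.trans Θ₂, by simp [← h₁, ← h₂]⟩

end Exp

/-! ### Conjugacy of the neutral elements of `𝔰𝔩₂`-triples through `e`. -/

section Conjugacy

variable {k : Type*} [Field k] {L : Type*} [LieRing L] [LieAlgebra k L] {e h f h' f' : L}

lemma lie_mem_highestWeightSpace {c d : k} {x y : L} (hx : x ∈ highestWeightSpace k L e h c)
    (hy : y ∈ highestWeightSpace k L e h d) : ⁅x, y⁆ ∈ highestWeightSpace k L e h (c + d) := by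
  obtain ⟨hx1, hx2⟩ := mem_highestWeightSpace.mp hx
  obtain ⟨hy1, hy2⟩ := mem_highestWeightSpace.mp hy
  rw [mem_highestWeightSpace]
  constructor
  · rw [leibniz_lie, hx1, hy1]; simp
  · rw [leibniz_lie, hx2, hy2, smul_lie, lie_smul, add_smul]

lemma lie_mem_highestWeightGE {m n : ℕ} {x y : L} (hx : x ∈ highestWeightSpace k L e h m)
    (hy : y ∈ highestWeightGE k L e h n) : ⁅x, y⁆ ∈ highestWeightGE k L e h (m + n) := by
  suffices H : highestWeightGE k L e h n ≤ (highestWeightGE k L e h (m + n)).comap (ad k L x) from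
    H hy
  refine highestWeightGE_le_iff.mpr fun j hj y hy => ?_
  refine highestWeightSpace_le_GE (Nat.add_le_add_left hj m) ?_
  have := lie_mem_highestWeightSpace hx hy
  rwa [← Nat.cast_add] at this

variable [CharZero k] [FiniteDimensional k L]

/-- If `x` is the weight `m` part of `h' - h`, then `z = x / m` satisfies `[z, h] = -x`, so `exp (ad
z)` removes `x` modulo higher weights; it fixes `e` because `z` commutes with `e`. -/
lemma exists_lieEquiv_sub_mem_succ {m : ℕ} (hm : 1 ≤ m) 
    (hd : h' - h ∈ highestWeightGE k L e h m) :
    ∃ Θ : L ≃ₗ⁅k⁆ L, Θ e = e ∧ Θ h' - h ∈ highestWeightGE k L e h (m + 1) := by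
  obtain ⟨x, hx, y, hy, hxy⟩ := Submodule.mem_sup.mp (highestWeightGE_le m hd)
  have hm0 : (m : k) ≠ 0 := by rw [Nat.cast_ne_zero]; lia
  set z := (m : k)⁻¹ • x with hz
  have hzm : z ∈ highestWeightSpace k L e h (m : k) := Submodule.smul_mem _ _ hx
  obtain ⟨hze, hzh⟩ := mem_highestWeightSpace.mp hzm
  have hzh' : ⁅z, h⁆ = -x := by
    rw [← lie_skew, hzh, hz, smul_smul, mul_inv_cancel₀ hm0, one_smul]
  have hze' : ⁅z, e⁆ = 0 := by rw [← lie_skew, hze, neg_zero]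
  have hnil : IsNilpotent (ad k L z) := by
    refine isNilpotent_of_mul_sub_mul_eq_smul (A := ad k L h) hm0 ?_
    ext v
    rw [LinearMap.sub_apply, LinearMap.smul_apply, Module.End.mul_apply, Module.End.mul_apply,
      ad_apply, ad_apply, ad_apply, ad_apply, leibniz_lie, hzh, smul_lie, add_sub_cancel_right]
  obtain ⟨Θ, hΘ⟩ := exists_lieEquiv_eq_sum hnil
  obtain ⟨N, hN⟩ := hnil
  -- Truncating at `N + 2` makes it possible to split off the terms of degree 0 and 1.
  have hΘ2 := hΘ (N + 2) (by rw [pow_add, hN, zero_mul])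
  have hΘv (v : L) : Θ v = (∑ i ∈ Finset.range N,
      ((i + 2).factorial : k)⁻¹ • ((ad k L z) ^ i) ⁅z, ⁅z, v⁆⁆) + ⁅z, v⁆ + v := by
    have := LinearMap.congr_fun hΘ2 v
    rw [Finset.sum_range_succ', Finset.sum_range_succ'] at this
    simpa [pow_succ, LinearMap.sum_apply] using this
  refine ⟨Θ, by rw [hΘv, hze']; simp, ?_⟩
  have hzd (n : ℕ) (v : L) (hv : v ∈ highestWeightGE k L e h n) :
      ⁅z, v⁆ ∈ highestWeightGE k L e h (n + 1) :=
    highestWeightGE_antitone (by lia) (lie_mem_highestWeightGE hzm hv)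
  have hx' : x ∈ highestWeightGE k L e h m := highestWeightSpace_le_GE le_rfl hx
  have hzd' := hzd m _ hd
  have hzh1 : ⁅z, h'⁆ = -x + ⁅z, h' - h⁆ := by rw [lie_sub, hzh']; abel
  have hzz : ⁅z, ⁅z, h'⁆⁆ ∈ highestWeightGE k L e h (m + 1) := by
    refine hzd m _ ?_
    rw [hzh1]
    exact add_mem (neg_mem hx') (highestWeightGE_antitone (by lia) hzd')
  have hpow (i : ℕ) :
      ((ad k L z) ^ i) ⁅z, ⁅z, h'⁆⁆ ∈ highestWeightGE k L e h (m + 1) := by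
    induction i with
    | zero => exact hzz
    | succ i ih =>
      rw [pow_succ', Module.End.mul_apply]
      exact highestWeightGE_antitone (by lia) (hzd _ _ ih)
  have heq : Θ h' - h = (∑ i ∈ Finset.range N,
      ((i + 2).factorial : k)⁻¹ • ((ad k L z) ^ i) ⁅z, ⁅z, h'⁆⁆) + (⁅z, h' - h⁆ + y) := by
    rw [hΘv, hzh1, eq_sub_of_add_eq' hxy]; abel
  rw [heq]
  exact add_mem (Submodule.sum_mem _ fun i _ => Submodule.smul_mem _ _ (hpow i)) (add_mem hzd' hy)

/-- The neutral elements of two `𝔰𝔩₂`-triples containing `e` are conjugate under the automorphisms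
fixing `e`. -/
theorem exists_lieEquiv_neutral_eq (t : IsSl2Triple h e f) (t' : IsSl2Triple h' e f') :
    ∃ Θ : L ≃ₗ⁅k⁆ L, Θ e = e ∧ Θ h' = h := by
  have H (m : ℕ) : ∃ Θ : L ≃ₗ⁅k⁆ L, Θ e = e ∧ Θ h' - h ∈ highestWeightGE k L e h (m + 1) := by
    induction m with
    | zero =>
      refine ⟨LieEquiv.refl, rfl, ?_⟩
      -- The difference lies in both the image and the kernel of `ad e`, hence has only positive
      -- weights.
      have h1 : h' - h = ⁅e, f' - f⁆ := by rw [lie_sub, t.lie_e_f, t'.lie_e_f]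
      change h' - h ∈ _
      rw [h1]
      refine lie_e_mem_highestWeightGE_one t ?_
      rw [← h1, lie_sub, ← lie_skew, ← lie_skew e h, t.lie_h_e_nsmul, t'.lie_h_e_nsmul, sub_self]
    | succ m ih =>
      obtain ⟨Θ, hΘe, hΘ⟩ := ih
      obtain ⟨Θ', hΘ'e, hΘ'⟩ := exists_lieEquiv_sub_mem_succ (by lia) hΘ
      exact ⟨Θ.trans Θ', by simp [hΘe, hΘ'e], by simpa using hΘ'⟩
  obtain ⟨N, hN⟩ := exists_highestWeightGE_eq_bot (k := k) (M := L) (e := e) (h := h)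
  obtain ⟨Θ, hΘe, hΘ⟩ := H N
  refine ⟨Θ, hΘe, ?_⟩
  have := highestWeightGE_antitone (Nat.le_succ N) hΘ
  rw [hN, Submodule.mem_bot] at this
  exact sub_eq_zero.mp this

end Conjugacy

/-! ### The matrix units of `𝔰𝔩₃`. -/

section StandardSystem

variable (k : Type*) [Field k]

lemma sl3System_sl :
    Sl3System (SpecialLinear.single (0 : Fin 3) 1 (by decide) (1 : k))
      (SpecialLinear.single (1 : Fin 3) 2 (by decide) (1 : k))
      (SpecialLinear.single (0 : Fin 3) 2 (by decide) (1 : k))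
      (SpecialLinear.single (1 : Fin 3) 0 (by decide) (1 : k))
      (SpecialLinear.single (2 : Fin 3) 1 (by decide) (1 : k))
      (SpecialLinear.single (2 : Fin 3) 0 (by decide) (1 : k))
      (SpecialLinear.singleSubSingle (0 : Fin 3) 1 (1 : k))
      (SpecialLinear.singleSubSingle (1 : Fin 3) 2 (1 : k))
      (SpecialLinear.singleSubSingle (0 : Fin 3) 2 (1 : k)) := by
  have hne (i j : Fin 3) (hij : i ≠ j) :
      SpecialLinear.singleSubSingle i j (1 : k) ≠ 0 := fun h0 => by
    have := congrFun (congrFun (congrArg Subtype.val h0) i) i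
    simp [hij.symm] at this
  constructor
  case triple₁ =>
    refine ⟨hne _ _ (by decide), ?_, ?_, ?_⟩ <;> apply Subtype.ext <;>
      simp [Ring.lie_def, mul_sub, sub_mul, two_smul] <;> abel
  case triple₂ =>
    refine ⟨hne _ _ (by decide), ?_, ?_, ?_⟩ <;> apply Subtype.ext <;>
      simp [Ring.lie_def, mul_sub, sub_mul, two_smul] <;> abel
  case triple =>
    refine ⟨hne _ _ (by decide), ?_, ?_, ?_⟩ <;> apply Subtype.ext <;>
      simp [Ring.lie_def, mul_sub, sub_mul, two_smul] <;> abel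
  all_goals
    apply Subtype.ext
    simp [Ring.lie_def, mul_sub, sub_mul]

end StandardSystem

/-! ### Moving the copy of `𝔰𝔩₃` onto the given triple. -/

section Transport

variable {k : Type*} [Field k] {L L' : Type*} [LieRing L] [LieAlgebra k L] [LieRing L']
  [LieAlgebra k L']

lemma _root_.IsSl2Triple.map_of_injective (φ : L →ₗ⁅k⁆ L') (hφ : Function.Injective φ) {h e f : L}
    (t : IsSl2Triple h e f) : IsSl2Triple (φ h) (φ e) (φ f) where
  h_ne_zero := (map_ne_zero_iff φ hφ).mpr t.h_ne_zero
  lie_e_f := by rw [← LieHom.map_lie, t.lie_e_f]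
  lie_h_e_nsmul := by rw [← LieHom.map_lie, t.lie_h_e_nsmul, map_nsmul]
  lie_h_f_nsmul := by rw [← LieHom.map_lie, t.lie_h_f_nsmul, map_neg, map_nsmul]

lemma Sl3System.map_of_injective (φ : L →ₗ⁅k⁆ L') (hφ : Function.Injective φ)
    {p q e p' q' f h₁ h₂ h : L} (s : Sl3System p q e p' q' f h₁ h₂ h) :
    Sl3System (φ p) (φ q) (φ e) (φ p') (φ q') (φ f) (φ h₁) (φ h₂) (φ h) where
  triple₁ := s.triple₁.map_of_injective φ hφ
  triple₂ := s.triple₂.map_of_injective φ hφ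
  triple := s.triple.map_of_injective φ hφ
  add := by rw [← map_add, s.add]
  p_q := by rw [← LieHom.map_lie, s.p_q]
  e_p := by rw [← LieHom.map_lie, s.e_p, map_zero]
  e_q := by rw [← LieHom.map_lie, s.e_q, map_zero]
  e_p' := by rw [← LieHom.map_lie, s.e_p', map_neg]
  e_q' := by rw [← LieHom.map_lie, s.e_q']
  p_f := by rw [← LieHom.map_lie, s.p_f, map_neg]
  q_f := by rw [← LieHom.map_lie, s.q_f]
  p_q' := by rw [← LieHom.map_lie, s.p_q', map_zero]
  q_p' := by rw [← LieHom.map_lie, s.q_p', map_zero]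
  h₁_q := by rw [← LieHom.map_lie, s.h₁_q, map_neg]
  h₁_q' := by rw [← LieHom.map_lie, s.h₁_q']
  h₂_p := by rw [← LieHom.map_lie, s.h₂_p, map_neg]
  h₂_p' := by rw [← LieHom.map_lie, s.h₂_p']
  h₁_h₂ := by rw [← LieHom.map_lie, s.h₁_h₂, map_zero]

/-- Every `𝔰𝔩₂`-triple of an element of a low-`A₂` orbit extends to a copy of `𝔰𝔩₃` in which
the element is a highest root vector. -/
lemma exists_sl3System [CharZero k] [FiniteDimensional k L] {O : Set L} (hO : IsLowA2Orbit k O)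
    {e h f : L} (he : e ∈ O) (t : IsSl2Triple h e f) :
    ∃ p q p' q' f' h₁ h₂ : L, Sl3System p q e p' q' f' h₁ h₂ h := by
  obtain ⟨-, -, ⟨x, -, rfl⟩, s, φ, -, hmin⟩ := hO
  have h13 : (φ (SpecialLinear.single (0 : Fin 3) 2 (by decide) (1 : k)) : L) ∈
      adjointOrbit k x := by
    have : (φ (SpecialLinear.single (0 : Fin 3) 2 (by decide) (1 : k)) : L) ∈
        (fun x => (φ x : L)) '' minimalOrbitSl3 k := ⟨_, ⟨1, one_mem _, rfl⟩, rfl⟩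
    rw [← hmin] at this
    exact this.1
  -- `Θ` carries the image of `E₁₃` to `e`; below, `Ψ` fixes `e` and corrects the neutral element to
  -- `h`.
  obtain ⟨Θ, hΘ⟩ := exists_lieEquiv_of_mem_adjointOrbit h13 he
  have hS := (sl3System_sl k).map_of_injective
    ((Θ : L →ₗ⁅k⁆ L).comp (s.incl.comp (φ : _ →ₗ⁅k⁆ s)))
    (Θ.injective.comp (Subtype.val_injective.comp φ.injective))
  simp only [LieHom.comp_apply] at hS
  rw [show (Θ : L →ₗ⁅k⁆ L) (s.incl ((φ : _ →ₗ⁅k⁆ s)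
    (SpecialLinear.single (0 : Fin 3) 2 (by decide) (1 : k)))) = e from hΘ] at hS
  obtain ⟨Ψ, hΨe, hΨh⟩ := exists_lieEquiv_neutral_eq (k := k) t hS.triple
  have := hS.map_of_injective (Ψ : L →ₗ⁅k⁆ L) Ψ.injective
  rw [show (Ψ : L →ₗ⁅k⁆ L) e = e from hΨe] at this
  rw [show (Ψ : L →ₗ⁅k⁆ L) _ = h from hΨh] at this
  exact ⟨_, _, _, _, _, _, _, this⟩

end Transport

/-! ### The grading of the centraliser. -/

section Centraliser

variable {k : Type*} [Field k] {L : Type*} [LieRing L] [LieAlgebra k L] {e h f : L}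

lemma mem_centraliserPiece {i : ℤ} {x : L} :
    x ∈ centraliserPiece k e h i ↔ ⁅e, x⁆ = 0 ∧ ⁅h, x⁆ = (i : k) • x := by
  simp [centraliserPiece, centraliser, gradedPiece, sub_eq_zero]

lemma centraliserPiece_natCast (n : ℕ) :
    centraliserPiece k e h n = highestWeightSpace k L e h n := by
  ext x
  simp [mem_centraliserPiece, mem_highestWeightSpace]

lemma lie_mem_centraliserPiece {i j : ℤ} {x y : L} (hx : x ∈ centraliserPiece k e h i)
    (hy : y ∈ centraliserPiece k e h j) : ⁅x, y⁆ ∈ centraliserPiece k e h (i + j) := by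
  obtain ⟨hx1, hx2⟩ := mem_centraliserPiece.mp hx
  obtain ⟨hy1, hy2⟩ := mem_centraliserPiece.mp hy
  rw [mem_centraliserPiece]
  constructor
  · rw [leibniz_lie, hx1, hy1]; simp
  · rw [leibniz_lie, hx2, hy2, smul_lie, lie_smul, Int.cast_add, add_smul]

lemma mem_lieRight {V : Submodule k L} {y z : L} : z ∈ lieRight k V y ↔ ∃ x ∈ V, ⁅x, y⁆ = z :=
  Iff.rfl

lemma lieRight_centraliserPiece_le {i : ℤ} {y : L} (hy : y ∈ centraliserPiece k e h 1) :
    lieRight k (centraliserPiece k e h (i - 1)) y ≤ centraliserPiece k e h i := by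
  intro z hz
  obtain ⟨x, hx, rfl⟩ := mem_lieRight.mp hz
  simpa using lie_mem_centraliserPiece hx hy

variable (k) in
/-- The centraliser as a subalgebra. -/
def centraliserLie (e : L) : LieSubalgebra k L where
  __ := centraliser k e
  lie_mem' {x y} hx hy := by
    have hx' : ⁅e, x⁆ = 0 := hx
    have hy' : ⁅e, y⁆ = 0 := hy
    change ⁅e, ⁅x, y⁆⁆ = 0
    rw [leibniz_lie, hx', hy']; simp

variable (k e h) in
/-- The sum of the positive graded pieces of the centraliser as a subalgebra. -/
def centraliserNilLie : LieSubalgebra k L where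
  __ := centraliserNil k e h
  lie_mem' {x y} hx hy := by
    have hle {i : ℤ} (hi : 1 ≤ i) : centraliserPiece k e h i ≤ centraliserNil k e h :=
      le_iSup₂_of_le i hi le_rfl
    have h1 (i : ℤ) (hi : 1 ≤ i) (x : L) (hx : x ∈ centraliserPiece k e h i) :
        centraliserNil k e h ≤ (centraliserNil k e h).comap (ad k L x) :=
      iSup₂_le fun j hj y hy => hle (by lia) (lie_mem_centraliserPiece hx hy)
    have h2 : centraliserNil k e h ≤ (centraliserNil k e h).comap (ad k L y) := by
      refine iSup₂_le fun i hi x hx => ?_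
      change ⁅y, x⁆ ∈ centraliserNil k e h
      rw [← lie_skew]
      exact neg_mem (h1 i hi x hx hy)
    change ⁅x, y⁆ ∈ centraliserNil k e h
    rw [← lie_skew]
    exact neg_mem (h2 hx)

lemma centraliser_le_iSup [CharZero k] [FiniteDimensional k L] (t : IsSl2Triple h e f) :
    centraliser k e ≤ ⨆ n : ℕ, centraliserPiece k e h n := by
  intro x hx
  simp_rw [centraliserPiece_natCast]
  exact mem_iSup_highestWeightSpace t hx

end Centraliser

end LowA2

/-! ### The theorem. -/

open LowA2 in
theorem theorem4p3 {k : Type*} [Field k] [IsAlgClosed k] [CharZero k]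
    {L : Type*} [LieRing L] [LieAlgebra k L] [FiniteDimensional k L] [LieAlgebra.IsSimple k L]
    (O : Set L) (hO : LowA2.IsLowA2Orbit k O) (e h f : L) (he : e ∈ O)
    (t : IsSl2Triple h e f) :
    (∃ e₁ ∈ LowA2.centraliserPiece k e h 1, ∃ e₂ ∈ LowA2.centraliserPiece k e h 1,
      (∀ i : ℤ, 1 ≤ i →
        LowA2.centraliserPiece k e h i =
          LowA2.lieRight k (LowA2.centraliserPiece k e h (i - 1)) e₁ ⊔
            LowA2.lieRight k (LowA2.centraliserPiece k e h (i - 1)) e₂) ∧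
      (LieSubalgebra.lieSpan k L
        ((LowA2.centraliserPiece k e h 0 : Set L) ∪ {e₁, e₂})).toSubmodule =
          LowA2.centraliser k e) ∧
    (LieSubalgebra.lieSpan k L (LowA2.centraliserPiece k e h 1 : Set L)).toSubmodule =
      LowA2.centraliserNil k e h ∧
    LowA2.centraliserNil k e h ≤
      LowA2.lieSpanBracket k (LowA2.centraliser k e) (LowA2.centraliser k e) := by
  obtain ⟨p, q, p', q', f', h₁, h₂, s⟩ := exists_sl3System hO he t
  have hp : p ∈ centraliserPiece k e h 1 := mem_centraliserPiece.mpr ⟨s.e_p, by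
    rw [← s.add, add_lie, s.triple₁.lie_h_e_nsmul, s.h₂_p, Int.cast_one, two_smul]; module⟩
  have hq : q ∈ centraliserPiece k e h 1 := mem_centraliserPiece.mpr ⟨s.e_q, by
    rw [← s.add, add_lie, s.triple₂.lie_h_e_nsmul, s.h₁_q, Int.cast_one, two_smul]; module⟩
  have hstep (i : ℤ) (hi : 1 ≤ i) : centraliserPiece k e h i =
      lieRight k (centraliserPiece k e h (i - 1)) p ⊔
        lieRight k (centraliserPiece k e h (i - 1)) q := by
    refine le_antisymm (fun w hw => ?_)
      (sup_le (lieRight_centraliserPiece_le hp) (lieRight_centraliserPiece_le hq))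
    obtain ⟨n, rfl⟩ : ∃ n : ℕ, i = (n + 1 : ℕ) := ⟨(i - 1).toNat, by lia⟩
    rw [centraliserPiece_natCast, Nat.cast_succ] at hw
    obtain ⟨u₁, hu₁, u₂, hu₂, rfl⟩ := s.exists_lie_add_lie_eq n hw
    rw [show ((n + 1 : ℕ) : ℤ) - 1 = n by push_cast; ring, centraliserPiece_natCast]
    -- The signs appear because `lieRight` has the generator on the right.
    exact Submodule.add_mem_sup (mem_lieRight.mpr ⟨-u₁, neg_mem hu₁, by rw [neg_lie, lie_skew]⟩)
      (mem_lieRight.mpr ⟨-u₂, neg_mem hu₂, by rw [neg_lie, lie_skew]⟩)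
  have hpiece (i : ℤ) : centraliserPiece k e h i ≤ centraliser k e := inf_le_left
  -- The common induction step of both generation statements, which start from weight 0 and weight 1
  -- respectively.
  have hle (A : LieSubalgebra k L) (hpA : p ∈ A) (hqA : q ∈ A) (i : ℤ) (hi : 1 ≤ i)
      (hA : centraliserPiece k e h (i - 1) ≤ A.toSubmodule) :
      centraliserPiece k e h i ≤ A.toSubmodule := by
    rw [hstep i hi]
    refine sup_le ?_ ?_ <;> intro z hz <;> obtain ⟨x, hx, rfl⟩ := mem_lieRight.mp hz
    · exact A.lie_mem (hA hx) hpA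
    · exact A.lie_mem (hA hx) hqA
  refine ⟨⟨p, hp, q, hq, hstep, le_antisymm ?_ ?_⟩, le_antisymm ?_ ?_, ?_⟩
  · refine LieSubalgebra.lieSpan_le (K := centraliserLie k e) |>.mpr ?_
    rintro x (hx | rfl | rfl)
    exacts [hpiece _ hx, hpiece _ hp, hpiece _ hq]
  · refine (centraliser_le_iSup t).trans (iSup_le fun n => ?_)
    induction n with
    | zero => exact fun x hx => LieSubalgebra.subset_lieSpan (.inl hx)
    | succ n ih =>
      refine hle _ (LieSubalgebra.subset_lieSpan (by simp)) (LieSubalgebra.subset_lieSpan (by simp))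
        _ (by lia) (by simpa using ih)
  · refine LieSubalgebra.lieSpan_le (K := centraliserNilLie k e h) |>.mpr ?_
    exact (le_iSup₂_of_le 1 le_rfl le_rfl : centraliserPiece k e h 1 ≤ centraliserNil k e h)
  · refine iSup₂_le fun i hi => ?_
    induction i, hi using Int.leInduction with
    | base => exact LieSubalgebra.subset_lieSpan
    | succ i hi ih =>
      refine hle _ (LieSubalgebra.subset_lieSpan hp) (LieSubalgebra.subset_lieSpan hq)
        _ (by lia) (by simpa using ih)
  · refine iSup₂_le fun i hi => ?_
    rw [hstep i hi]
    refine sup_le ?_ ?_ <;> intro z hz <;> obtain ⟨x, hx, rfl⟩ := mem_lieRight.mp hz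
    · exact Submodule.subset_span ⟨x, hpiece _ hx, p, hpiece _ hp, rfl⟩
    · exact Submodule.subset_span ⟨x, hpiece _ hx, q, hpiece _ hq, rfl⟩
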